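/- Let $G$ be a connected graph on $N\ge 1$ nodes. Each node holds one of the four opinions $S^+,S^-,W^+,W^-$ (strong/weak, positive/negative), with numerical values $S^{\pm}=\pm 2$, $W^{\pm}=\pm 1$. Initially every node casts a vote and holds $S^+$ or $S^-$ accordingly; assume that the numbers of initial $S^+$ and $S^-$ opinions are different (this is automatic if $N$ is odd). Every node has an independent rate-$1$ exponential clock; equivalently, at each tick $t=0,1,2,\dots$ of the global clock, independently of the past, a uniformly random node $i$ is selected and chooses a uniformly random neighbour $j$ (if $N=1$, nothing happens). Their opinions $a$ (of $i$) and $b$ (of $j$) are replaced as follows, all other opinions being unchanged: 1. if $a=b$, nothing changes; 2. if $|a|>|b|$ and $ab<0$, then $i$ gets $-b$ and $j$ gets $a$; symmetrically, if $|b|>|a|$ and $ab<0$, then $j$ gets $-a$ and $i$ gets $b$; 3. if $|a|\ne|b|$ and $ab>0$, then $i$ gets $b$ and $j$ gets $a$; 4. if $a=-b$, then $i$ gets $\operatorname{sign}(b)$ and $j$ gets $\operatorname{sign}(a)$. Let $T$ be the number of global clock ticks until, for the first time, all opinions are positive or all opinions are negative ($T=\infty$ if this never happens). Then $$\mathbb{E}[T]=O(N^4\log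 N),$$ i.e. there is an absolute constant $C>0$ such that $\mathbb{E}[T]\le C\,N^4\log N$ for every $N\ge 1$, every connected graph $G$ on $N$ nodes and every initial vote that is not tied. -/

import Mathlib

open MeasureTheory ProbabilityTheory
open scoped ENNReal

namespace BinaryVoting

/-- The four opinions: strong positive, strong negative, weak positive, weak negative. -/
inductive Opinion where
  | strongPos
  | strongNeg
  | weakPos
  | weakNeg
  deriving DecidableEq

namespace Opinion

/-- Numerical values `S⁺ = 2`, `S⁻ = -2`, `W⁺ = 1`, `W⁻ = -1`. -/
def val : Opinion → ℤ
  | strongPos => 2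
  | strongNeg => -2
  | weakPos => 1
  | weakNeg => -1

/-- The new opinions of the two nodes of an activated edge (in the same order). Opposite strong
opinions both become weak; a strong opinion moves and turns a weak opinion of the opposite sign
to its own sign; in all other cases the two opinions are exchanged. -/
def interact : Opinion → Opinion → Opinion × Opinion
  | strongPos, strongNeg => (weakNeg, weakPos)
  | strongNeg, strongPos => (weakPos, weakNeg)
  | strongPos, weakNeg => (weakPos, strongPos)
  | weakNeg, strongPos => (strongPos, weakPos)
  | strongNeg, weakPos => (weakNeg, strongNeg)
  | weakPos, strongNeg => (strongNeg, weakNeg)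
  | a, b => (b, a)

/-- The same update rules, expressed through the numerical values. -/
theorem interact_rules (a b : Opinion) :
    (a.val = b.val → (interact a b).1.val = a.val ∧ (interact a b).2.val = a.val) ∧
    (|b.val| < |a.val| → a.val * b.val < 0 →
      (interact a b).1.val = -b.val ∧ (interact a b).2.val = a.val) ∧
    (|a.val| < |b.val| → a.val * b.val < 0 →
      (interact a b).1.val = b.val ∧ (interact a b).2.val = -a.val) ∧
    (|a.val| ≠ |b.val| → 0 < a.val * b.val →
      (interact a b).1.val = b.val ∧ (interact a b).2.val = a.val) ∧
    (a.val = -b.val →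
      (interact a b).1.val = b.val.sign ∧ (interact a b).2.val = a.val.sign) := by
  cases a <;> cases b <;> decide

end Opinion

/-- A configuration assigns an opinion to each of the `N` nodes. -/
abbrev Config (N : ℕ) := Fin N → Opinion

/-- The initial configuration given by the votes of the nodes: every opinion is strong. -/
def initial {N : ℕ} (vote : Fin N → Bool) : Config N :=
  fun i => if vote i then Opinion.strongPos else Opinion.strongNeg

/-- One update: the nodes `e.1` and `e.2` interact, all other nodes keep their opinions. -/
def step {N : ℕ} (x : Config N) (e : Fin N × Fin N) : Config N :=
  fun k =>
    if k = e.1 then (Opinion.interact (x e.1) (x e.2)).1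
    else if k = e.2 then (Opinion.interact (x e.1) (x e.2)).2
    else x k

/-- The configuration after `t` ticks of the global clock, where the `s`-th tick (counted from
`0`) activates the pair `a s`. -/
def trajectory {N : ℕ} (x : Config N) (a : ℕ → Fin N × Fin N) : ℕ → Config N
  | 0 => x
  | t + 1 => step (trajectory x a t) (a t)

/-- Consensus: all opinions are positive, or all opinions are negative. -/
def Converged {N : ℕ} (x : Config N) : Prop :=
  (∀ i, 0 < (x i).val) ∨ (∀ i, (x i).val < 0)

/-- The first time (number of clock ticks) at which consensus holds; `∞` if there is none. -/
noncomputable def convergenceTime {N : ℕ} (x : Config N) (a : ℕ → Fin N × Fin N) : ℝ≥0∞ :=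
  ⨅ (t : ℕ) (_ : Converged (trajectory x a t)), (t : ℝ≥0∞)

open Classical in
/-- The law of the activated pair at a tick of the global clock: the ticking node is uniform
among all nodes, and it chooses one of its neighbours uniformly. A node without neighbours
(this occurs in a connected graph only if `N = 1`) is paired with itself, so nothing happens. -/
noncomputable def activation {N : ℕ} [NeZero N] (G : SimpleGraph (Fin N)) :
    PMF (Fin N × Fin N) :=
  (PMF.uniformOfFintype (Fin N)).bind fun i =>
    if h : (G.neighborFinset i).Nonempty then
      (PMF.uniformOfFinset (G.neighborFinset i) h).map fun j => (i, j)
    else PMF.pure (i, i)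

end BinaryVoting

/-!
Attach the opinions to tokens: at each tick the two tokens on the activated edge change places, so
the positions of the tokens form an interchange process that does not depend on the opinions, and
a token changes its label only through an encounter. Strong labels are never created; opposite
strong labels do not survive an encounter (`unmet_of_strong`); and once one of the strong signs has
died out, a surviving strong token converts every weak token of opposite sign that it meets
(`unmet_of_weakNeg`). The difference between the numbers of the two strong labels is conserved, so
the majority sign does survive. Hence two consecutive windows of time, in each of which every pair
of tokens meets, produce consensus (`converged_of_windows`).

It remains to bound the time at which two tokens meet. Their positions form a symmetric Markov chain
on the `N ^ 2` pairs of nodes, killed at the encounter. Let `H` be the expected killing time,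
truncated at a finite horizon. Then `H - K H ≤ 1` for the transition operator `K`, so the Dirichlet
form `∑ x, H x * (H x - K H x)` is at most `N ^ 2 * max H`. Conversely, with one token frozen at `v`,
the Dirichlet form dominates that of a single walk absorbed at `v` (`sum_sq_sub_le_energy`), and the
Cauchy-Schwarz inequality along a geodesic, whose degrees add up to at most `3 N`, gives
`(max H) ^ 2 ≤ 3 N ^ 2 * ∑ x, H x * (H x - K H x)` (`sq_sub_le_energy`). Therefore
`max H ≤ 3 N ^ 4` (`sum_avoid_le`), a given pair is unmet after `6 N ^ 4` ticks with probability at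
most `1 / 2`, and it is unmet after `6 N ^ 4 * k` ticks with probability at most `2 ^ (-k)`. A
logarithmic `k` makes the union bound over all pairs work (`measure_badWindow_le`). As disjoint
blocks of two windows are independent, the number of blocks until consensus is dominated by a
geometric variable (`measure_allBad_le`, `convergenceTime_le_tsum`).
-/

namespace BinaryVoting

/-! ### Tokens and the interchange process -/

/-- Opinions are attached to tokens, and at each tick the two tokens on the activated edge change
places. `tokenPos a t u` is the position after `t` ticks of the token that starts at `u`. -/
def tokenPos {V : Type*} [DecidableEq V] (a : ℕ → V × V) : ℕ → Equiv.Perm V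
  | 0 => 1
  | t + 1 => Equiv.swap (a t).1 (a t).2 * tokenPos a t

/-- The activated pair `e` consists of the nodes `u` and `v`, in one of the two orders. -/
def Meets {V : Type*} (e : V × V) (u v : V) : Prop := e = (u, v) ∨ e = (v, u)

/-- The tokens starting at `u` and `v` do not interact during the first `n` ticks. -/
def Unmet {V : Type*} [DecidableEq V] (a : ℕ → V × V) (n : ℕ) (u v : V) : Prop :=
  ∀ k < n, ¬ Meets (a k) (tokenPos a k u) (tokenPos a k v)

theorem tokenPos_succ_front {V : Type*} [DecidableEq V] (a : ℕ → V × V) (n : ℕ) (u : V) :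
    tokenPos a (n + 1) u =
      tokenPos (fun t => a (t + 1)) n (Equiv.swap (a 0).1 (a 0).2 u) := by
  induction n with
  | zero => rfl
  | succ n ih =>
    rw [tokenPos, Equiv.Perm.mul_apply, ih]
    rfl

theorem unmet_succ {V : Type*} [DecidableEq V] (a : ℕ → V × V) (n : ℕ) (u v : V) :
    Unmet a (n + 1) u v ↔ ¬ Meets (a 0) u v ∧
      Unmet (fun t => a (t + 1)) n (Equiv.swap (a 0).1 (a 0).2 u)
        (Equiv.swap (a 0).1 (a 0).2 v) := by
  constructor
  · intro h
    refine ⟨h 0 (Nat.succ_pos n), fun k hk => ?_⟩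
    have := h (k + 1) (Nat.succ_lt_succ hk)
    rwa [tokenPos_succ_front, tokenPos_succ_front] at this
  · rintro ⟨h0, h⟩ k hk
    cases k with
    | zero => exact h0
    | succ k =>
      rw [tokenPos_succ_front, tokenPos_succ_front]
      exact h k (Nat.lt_of_succ_lt_succ hk)

theorem tokenPos_congr {V : Type*} [DecidableEq V] {a b : ℕ → V × V} {n : ℕ}
    (h : ∀ k < n, a k = b k) : tokenPos a n = tokenPos b n := by
  induction n with
  | zero => rfl
  | succ n ih => rw [tokenPos, tokenPos, ih fun k hk => h k (hk.trans n.lt_succ_self),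
      h n n.lt_succ_self]

theorem unmet_congr {V : Type*} [DecidableEq V] {a b : ℕ → V × V} {n : ℕ}
    (h : ∀ k < n, a k = b k) (u v : V) : Unmet a n u v ↔ Unmet b n u v := by
  refine forall₂_congr fun k hk => ?_
  rw [h k hk, tokenPos_congr fun j hj => h j (hj.trans hk)]

theorem meets_swap {V : Type*} [DecidableEq V] (e : V × V) (u v : V) :
    Meets e (Equiv.swap e.1 e.2 u) (Equiv.swap e.1 e.2 v) ↔ Meets e u v := by
  obtain ⟨i, j⟩ := e
  have key : ∀ u v : V, Meets (i, j) u v →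
      Meets (i, j) (Equiv.swap i j u) (Equiv.swap i j v) := by
    rintro u v (h | h) <;> obtain ⟨rfl, rfl⟩ := Prod.mk.inj h <;> simp [Meets]
  refine ⟨fun h => ?_, key u v⟩
  simpa using key _ _ h

/-! ### Labels of tokens -/

theorem interact_fst (a b : Opinion) :
    (Opinion.interact a b).1 = (Opinion.interact b a).2 := by
  cases a <;> cases b <;> rfl

/-- The new label of the token at `p` is found where the token is after the tick; it changes only
through the token met on the activated edge. -/
theorem step_swap {N : ℕ} (y : Config N) (e : Fin N × Fin N) (p : Fin N) :
    step y e (Equiv.swap e.1 e.2 p) =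
      if p = e.1 then (Opinion.interact (y p) (y e.2)).2
      else if p = e.2 then (Opinion.interact (y p) (y e.1)).2
      else y p := by
  obtain ⟨i, j⟩ := e
  by_cases h1 : p = i
  · subst h1
    by_cases h : j = p
    · subst h; simp [step, interact_fst]
    · simp [step, h]
  · by_cases h2 : p = j
    · subst h2; simp [step, h1, interact_fst]
    · simp [step, h1, h2, Equiv.swap_apply_of_ne_of_ne]

theorem strongPos_of_step {N : ℕ} {y : Config N} {e : Fin N × Fin N} {p : Fin N}
    (h : step y e (Equiv.swap e.1 e.2 p) = .strongPos) : y p = .strongPos := by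
  rw [step_swap] at h
  generalize y e.1 = a at h
  generalize y e.2 = b at h
  generalize y p = c at h ⊢
  split_ifs at h <;> cases a <;> cases b <;> cases c <;> simp_all [Opinion.interact]

theorem strongNeg_of_step {N : ℕ} {y : Config N} {e : Fin N × Fin N} {p : Fin N}
    (h : step y e (Equiv.swap e.1 e.2 p) = .strongNeg) : y p = .strongNeg := by
  rw [step_swap] at h
  generalize y e.1 = a at h
  generalize y e.2 = b at h
  generalize y p = c at h ⊢
  split_ifs at h <;> cases a <;> cases b <;> cases c <;> simp_all [Opinion.interact]

theorem not_meets_of_step_strong {N : ℕ} {y : Config N} {e : Fin N × Fin N} {p q : Fin N}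
    (hp : step y e (Equiv.swap e.1 e.2 p) = .strongPos)
    (hq : step y e (Equiv.swap e.1 e.2 q) = .strongNeg) : ¬ Meets e p q := by
  have hp' := strongPos_of_step hp
  have hq' := strongNeg_of_step hq
  rw [step_swap] at hp
  rintro (h | h)
  · simp [h, hp', hq', Opinion.interact] at hp
  · by_cases hpq : p = q
    · simp_all
    · simp [h, hp', hq', hpq, Opinion.interact] at hp

theorem ne_strongNeg_step {N : ℕ} {y : Config N} (hy : ∀ k, y k ≠ .strongNeg)
    (e : Fin N × Fin N) (k : Fin N) : step y e k ≠ .strongNeg := by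
  obtain ⟨k, rfl⟩ := (Equiv.swap e.1 e.2).surjective k
  exact fun h => hy _ (strongNeg_of_step h)

theorem strongPos_step {N : ℕ} {y : Config N} (hy : ∀ k, y k ≠ .strongNeg)
    (e : Fin N × Fin N) {p : Fin N} (hp : y p = .strongPos) :
    step y e (Equiv.swap e.1 e.2 p) = .strongPos := by
  rw [step_swap, hp]
  have h1 := hy e.1
  have h2 := hy e.2
  generalize y e.1 = a at h1 ⊢
  generalize y e.2 = b at h2 ⊢
  cases a <;> cases b <;> simp_all [Opinion.interact]

theorem weakNeg_of_step {N : ℕ} {y : Config N} (hy : ∀ k, y k ≠ .strongNeg)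
    {e : Fin N × Fin N} {p : Fin N}
    (h : step y e (Equiv.swap e.1 e.2 p) = .weakNeg) : y p = .weakNeg := by
  rw [step_swap] at h
  have h1 := hy e.1
  have h2 := hy e.2
  have h3 := hy p
  generalize y e.1 = a at h h1
  generalize y e.2 = b at h h2
  generalize y p = c at h h3 ⊢
  split_ifs at h <;> cases a <;> cases b <;> cases c <;> simp_all [Opinion.interact]

theorem not_meets_of_step_weakNeg {N : ℕ} {y : Config N} (hy : ∀ k, y k ≠ .strongNeg)
    {e : Fin N × Fin N} {p q : Fin N} (hp : y p = .strongPos)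
    (hq : step y e (Equiv.swap e.1 e.2 q) = .weakNeg) : ¬ Meets e p q := by
  have hq' := weakNeg_of_step hy hq
  rw [step_swap] at hq
  rintro (h | h)
  · by_cases hpq : q = p
    · simp_all
    · simp [h, hp, hq', hpq, Opinion.interact] at hq
  · simp [h, hp, hq', Opinion.interact] at hq

theorem trajectory_add {N : ℕ} (x : Config N) (a : ℕ → Fin N × Fin N) (s n : ℕ) :
    trajectory x a (s + n) = trajectory (trajectory x a s) (fun t => a (s + t)) n := by
  induction n with
  | zero => rfl
  | succ n ih => rw [← add_assoc, trajectory, ih]; rfl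

/-- Strong labels are never created, and opposite strong labels do not survive an encounter. -/
theorem unmet_of_strong {N : ℕ} (x : Config N) (a : ℕ → Fin N × Fin N) (n : ℕ) {p q : Fin N}
    (hp : trajectory x a n (tokenPos a n p) = .strongPos)
    (hq : trajectory x a n (tokenPos a n q) = .strongNeg) : Unmet a n p q := by
  induction n with
  | zero => intro k hk; omega
  | succ n ih =>
    have h := ih (strongPos_of_step hp) (strongNeg_of_step hq)
    intro k hk
    rcases Nat.lt_succ_iff_lt_or_eq.mp hk with hk | rfl
    · exact h k hk
    · exact not_meets_of_step_strong hp hq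

theorem trajectory_ne_strongNeg {N : ℕ} {x : Config N} (hx : ∀ k, x k ≠ .strongNeg)
    (a : ℕ → Fin N × Fin N) (n : ℕ) (k : Fin N) : trajectory x a n k ≠ .strongNeg := by
  induction n generalizing k with
  | zero => exact hx k
  | succ n ih => exact ne_strongNeg_step ih _ k

theorem strongPos_trajectory {N : ℕ} {x : Config N} (hx : ∀ k, x k ≠ .strongNeg)
    (a : ℕ → Fin N × Fin N) (n : ℕ) {p : Fin N} (hp : x p = .strongPos) :
    trajectory x a n (tokenPos a n p) = .strongPos := by
  induction n with
  | zero => exact hp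
  | succ n ih => exact strongPos_step (trajectory_ne_strongNeg hx a n) _ ih

/-- In the absence of strong negative opinions, weak negative labels are never created, and they
do not survive an encounter with a strong positive one. -/
theorem unmet_of_weakNeg {N : ℕ} {x : Config N} (hx : ∀ k, x k ≠ .strongNeg)
    (a : ℕ → Fin N × Fin N) (n : ℕ) {p q : Fin N} (hp : x p = .strongPos)
    (hq : trajectory x a n (tokenPos a n q) = .weakNeg) : Unmet a n p q := by
  induction n with
  | zero => intro k hk; omega
  | succ n ih =>
    have hn := trajectory_ne_strongNeg hx a n
    have h := ih (weakNeg_of_step hn hq)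
    intro k hk
    rcases Nat.lt_succ_iff_lt_or_eq.mp hk with hk | rfl
    · exact h k hk
    · exact not_meets_of_step_weakNeg hn (strongPos_trajectory hx a k hp) hq

/-! ### The conserved imbalance -/

/-- The contribution of an opinion to the difference between the numbers of strong positive and
strong negative opinions. -/
def Opinion.strongSign : Opinion → ℤ
  | .strongPos => 1
  | .strongNeg => -1
  | _ => 0

/-- The number of strong positive opinions minus the number of strong negative ones. -/
def imbalance {N : ℕ} (x : Config N) : ℤ := ∑ k, (x k).strongSign

theorem imbalance_step {N : ℕ} (x : Config N) (e : Fin N × Fin N) :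
    imbalance (step x e) = imbalance x := by
  obtain ⟨i, j⟩ := e
  rw [← sub_eq_zero, imbalance, imbalance, ← Finset.sum_sub_distrib]
  by_cases hij : i = j
  · subst hij
    refine Finset.sum_eq_zero fun k _ => ?_
    by_cases hk : k = i
    · subst hk
      simp only [step, if_true]
      cases x k <;> simp [Opinion.interact]
    · simp [step, hk]
  · rw [Fintype.sum_eq_add i j hij (by rintro k ⟨h1, h2⟩; simp [step, h1, h2])]
    simp only [step, if_true, Ne.symm hij, if_false]
    cases x i <;> cases x j <;> simp [Opinion.interact, Opinion.strongSign]

theorem imbalance_trajectory {N : ℕ} (x : Config N) (a : ℕ → Fin N × Fin N) (n : ℕ) :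
    imbalance (trajectory x a n) = imbalance x := by
  induction n with
  | zero => rfl
  | succ n ih => rw [trajectory, imbalance_step, ih]

theorem exists_strongPos_of_imbalance_pos {N : ℕ} {x : Config N} (h : 0 < imbalance x) :
    ∃ k, x k = .strongPos := by
  obtain ⟨k, -, hk⟩ := Finset.exists_lt_of_sum_lt
    (show ∑ _k : Fin N, (0 : ℤ) < ∑ k, (x k).strongSign by simpa [imbalance] using h)
  refine ⟨k, ?_⟩
  revert hk
  cases x k <;> simp [Opinion.strongSign]

/-! ### Exchanging the signs -/

/-- The opinion of the same strength and the opposite sign. -/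
def Opinion.flip : Opinion → Opinion
  | .strongPos => .strongNeg
  | .strongNeg => .strongPos
  | .weakPos => .weakNeg
  | .weakNeg => .weakPos

theorem Opinion.val_flip (a : Opinion) : a.flip.val = -a.val := by cases a <;> rfl

theorem step_flip {N : ℕ} (x : Config N) (e : Fin N × Fin N) :
    step (fun k => (x k).flip) e = fun k => (step x e k).flip := by
  have h : ∀ a b : Opinion, Opinion.interact a.flip b.flip =
      ((Opinion.interact a b).1.flip, (Opinion.interact a b).2.flip) := by
    intro a b; cases a <;> cases b <;> rfl
  funext k
  simp only [step, h]
  split_ifs <;> rfl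

theorem trajectory_flip {N : ℕ} (x : Config N) (a : ℕ → Fin N × Fin N) (n : ℕ) :
    trajectory (fun k => (x k).flip) a n = fun k => (trajectory x a n k).flip := by
  induction n with
  | zero => rfl
  | succ n ih => rw [trajectory, ih, step_flip]; rfl

theorem converged_of_flip {N : ℕ} {x : Config N} (h : Converged fun k => (x k).flip) :
    Converged x := by
  simpa [Converged, Opinion.val_flip, or_comm] using h

theorem imbalance_flip {N : ℕ} (x : Config N) :
    imbalance (fun k => (x k).flip) = -imbalance x := by
  rw [imbalance, imbalance, ← Finset.sum_neg_distrib]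
  refine Finset.sum_congr rfl fun k _ => ?_
  cases x k <;> rfl

/-! ### Two windows in which all tokens meet -/

/-- Within `n` ticks, some pair of distinct tokens does not interact. -/
def BadWindow {V : Type*} [DecidableEq V] (a : ℕ → V × V) (n : ℕ) : Prop :=
  ∃ u v, u ≠ v ∧ Unmet a n u v

theorem converged_of_imbalance_pos {N : ℕ} {x : Config N} (hx : 0 < imbalance x)
    (a : ℕ → Fin N × Fin N) (n : ℕ) (h1 : ¬ BadWindow a n)
    (h2 : ¬ BadWindow (fun t => a (n + t)) n) : Converged (trajectory x a (n + n)) := by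
  -- The first window removes one of the two strong signs, and the imbalance protects the other.
  have hneg : ∀ k, trajectory x a n k ≠ .strongNeg := by
    intro q hq
    obtain ⟨p, hp⟩ := exists_strongPos_of_imbalance_pos
      (x := trajectory x a n) (by rwa [imbalance_trajectory])
    obtain ⟨p, rfl⟩ := (tokenPos a n).surjective p
    obtain ⟨q, rfl⟩ := (tokenPos a n).surjective q
    refine h1 ⟨p, q, ?_, unmet_of_strong x a n hp hq⟩
    rintro rfl
    simp [hp] at hq
  obtain ⟨p, hp⟩ := exists_strongPos_of_imbalance_pos
    (x := trajectory x a n) (by rwa [imbalance_trajectory])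
  -- In the second window a surviving strong token converts all weak tokens of the other sign.
  left
  rw [trajectory_add]
  intro k
  have hk := trajectory_ne_strongNeg hneg (fun t => a (n + t)) n k
  have hw : trajectory (trajectory x a n) (fun t => a (n + t)) n k ≠ .weakNeg := by
    intro hk
    obtain ⟨q, rfl⟩ := (tokenPos (fun t => a (n + t)) n).surjective k
    by_cases hpq : p = q
    · subst hpq
      rw [strongPos_trajectory hneg _ n hp] at hk
      cases hk
    · exact h2 ⟨p, q, hpq, unmet_of_weakNeg hneg _ n hp hk⟩
  revert hk hw
  cases trajectory (trajectory x a n) (fun t => a (n + t)) n k <;> simp [Opinion.val]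

theorem converged_of_windows {N : ℕ} {x : Config N} (hx : imbalance x ≠ 0)
    (a : ℕ → Fin N × Fin N) (n : ℕ) (h1 : ¬ BadWindow a n)
    (h2 : ¬ BadWindow (fun t => a (n + t)) n) : Converged (trajectory x a (n + n)) := by
  rcases hx.lt_or_gt with hx | hx
  · apply converged_of_flip
    rw [← trajectory_flip]
    exact converged_of_imbalance_pos (by rw [imbalance_flip]; omega) a n h1 h2
  · exact converged_of_imbalance_pos hx a n h1 h2

theorem imbalance_initial_ne_zero {N : ℕ} (vote : Fin N → Bool)
    (h : (Finset.univ.filter fun i => initial vote i = .strongPos).card ≠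
      (Finset.univ.filter fun i => initial vote i = .strongNeg).card) :
    imbalance (initial vote) ≠ 0 := by
  have key : imbalance (initial vote) =
      ((Finset.univ.filter fun i => initial vote i = .strongPos).card : ℤ) -
      (Finset.univ.filter fun i => initial vote i = .strongNeg).card := by
    rw [imbalance, Finset.card_filter, Finset.card_filter]
    push_cast
    rw [← Finset.sum_sub_distrib]
    refine Finset.sum_congr rfl fun k _ => ?_
    cases initial vote k <;> simp [Opinion.strongSign]
  rw [key]
  omega

/-! ### The pair walk killed at the encounter -/

open Classical in
/-- The transition operator of the positions of two tokens when a pair `e` is activated with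
probability `w e`, killed when the two tokens interact. -/
noncomputable def killedPair {V : Type*} [Fintype V] [DecidableEq V] (w : V × V → ℝ)
    (f : V × V → ℝ) (x : V × V) : ℝ :=
  ∑ e, if Meets e x.1 x.2 then 0
    else w e * f (Equiv.swap e.1 e.2 x.1, Equiv.swap e.1 e.2 x.2)

/-- The probability that the tokens starting at `x.1 ≠ x.2` do not interact during `n` ticks. It is
set to `0` on the diagonal, which the killed walk neither enters nor leaves. -/
noncomputable def avoid {V : Type*} [Fintype V] [DecidableEq V] (w : V × V → ℝ) : ℕ → V × V → ℝ
  | 0 => fun x => if x.1 = x.2 then 0 else 1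
  | n + 1 => killedPair w (avoid w n)

section
variable {V : Type*} [Fintype V] [DecidableEq V] {w : V × V → ℝ}

theorem killedPair_mono (hw : ∀ e, 0 ≤ w e) {f g : V × V → ℝ} (h : ∀ x, f x ≤ g x) (x : V × V) :
    killedPair w f x ≤ killedPair w g x := by
  classical
  refine Finset.sum_le_sum fun e _ => ?_
  split_ifs
  · exact le_rfl
  · exact mul_le_mul_of_nonneg_left (h _) (hw e)

theorem killedPair_const_mul (c : ℝ) (f : V × V → ℝ) (x : V × V) :
    killedPair w (fun y => c * f y) x = c * killedPair w f x := by
  classical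
  rw [killedPair, killedPair, Finset.mul_sum]
  refine Finset.sum_congr rfl fun e _ => ?_
  split_ifs
  · simp
  · ring

theorem killedPair_sum (n : ℕ) (f : ℕ → V × V → ℝ) (x : V × V) :
    killedPair w (fun y => ∑ k ∈ Finset.range n, f k y) x =
      ∑ k ∈ Finset.range n, killedPair w (f k) x := by
  classical
  simp only [killedPair]
  rw [Finset.sum_comm]
  refine Finset.sum_congr rfl fun e _ => ?_
  split_ifs
  · simp
  · rw [Finset.mul_sum]

theorem avoid_nonneg (hw : ∀ e, 0 ≤ w e) (n : ℕ) (x : V × V) : 0 ≤ avoid w n x := by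
  classical
  induction n generalizing x with
  | zero => simp only [avoid]; split_ifs <;> norm_num
  | succ n ih =>
    refine Finset.sum_nonneg fun e _ => ?_
    split_ifs
    · exact le_rfl
    · exact mul_nonneg (hw e) (ih _)

theorem avoid_diag (n : ℕ) (u : V) : avoid w n (u, u) = 0 := by
  classical
  induction n generalizing u with
  | zero => simp [avoid]
  | succ n ih =>
    refine Finset.sum_eq_zero fun e _ => ?_
    simp [ih]

theorem avoid_succ_le (hw : ∀ e, 0 ≤ w e) (h1 : ∑ e, w e = 1) (n : ℕ) (x : V × V) :
    avoid w (n + 1) x ≤ avoid w n x := by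
  classical
  induction n generalizing x with
  | zero =>
    obtain ⟨u, v⟩ := x
    by_cases huv : u = v
    · subst huv; simp [avoid_diag]
    · have h0 : avoid w 0 (u, v) = 1 := by simp [avoid, huv]
      rw [h0, ← h1]
      refine Finset.sum_le_sum fun e _ => ?_
      split_ifs
      · exact hw e
      · simp only [avoid]
        split_ifs
        · simpa using hw e
        · simp
  | succ n ih => exact killedPair_mono hw ih x

theorem avoid_antitone (hw : ∀ e, 0 ≤ w e) (h1 : ∑ e, w e = 1) (x : V × V) :
    Antitone fun n => avoid w n x :=
  antitone_nat_of_succ_le fun n => avoid_succ_le hw h1 n x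

theorem avoid_add_le (hw : ∀ e, 0 ≤ w e) {n : ℕ} {c : ℝ} (hc : ∀ x, avoid w n x ≤ c)
    (m : ℕ) (x : V × V) : avoid w (m + n) x ≤ c * avoid w m x := by
  induction m generalizing x with
  | zero =>
    obtain ⟨u, v⟩ := x
    rw [zero_add]
    by_cases huv : u = v
    · subst huv; simp [avoid_diag]
    · simpa [avoid, huv] using hc (u, v)
  | succ m ih =>
    rw [Nat.succ_add]
    exact (killedPair_mono hw ih x).trans_eq (killedPair_const_mul c _ x)

theorem avoid_mul_le_pow (hw : ∀ e, 0 ≤ w e) {n : ℕ} {c : ℝ} (hc0 : 0 ≤ c)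
    (hc : ∀ x, avoid w n x ≤ c) (k : ℕ) (x : V × V) : avoid w (k * n) x ≤ c ^ k := by
  induction k with
  | zero => simp only [zero_mul, avoid, pow_zero]; split_ifs <;> norm_num
  | succ k ih =>
    rw [Nat.succ_mul, pow_succ']
    exact (avoid_add_le hw hc _ x).trans (mul_le_mul_of_nonneg_left ih hc0)

open Classical in
/-- The Dirichlet form of the killed pair walk: since the transition operator is symmetric, it is
a sum of squares over transitions, with a term `f x ^ 2` for each possibility of being killed. -/
theorem sum_mul_sub_killedPair (h1 : ∑ e, w e = 1) (f : V × V → ℝ) :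
    ∑ x, f x * (f x - killedPair w f x) =
      ∑ e, w e * ∑ x : V × V, if Meets e x.1 x.2 then f x ^ 2 else
        (f x - f (Equiv.swap e.1 e.2 x.1, Equiv.swap e.1 e.2 x.2)) ^ 2 / 2 := by
  have hl : ∀ x, f x * (f x - killedPair w f x) = ∑ e, w e * (f x ^ 2 -
      if Meets e x.1 x.2 then 0
        else f x * f (Equiv.swap e.1 e.2 x.1, Equiv.swap e.1 e.2 x.2)) := by
    intro x
    simp only [mul_sub, Finset.sum_sub_distrib, ← Finset.sum_mul, h1, killedPair, Finset.mul_sum]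
    congr 1
    · ring
    · refine Finset.sum_congr rfl fun e _ => ?_
      split_ifs
      · simp
      · ring
  simp_rw [hl]
  rw [Finset.sum_comm]
  refine Finset.sum_congr rfl fun e _ => ?_
  rw [← Finset.mul_sum]
  congr 1
  have hs : ∑ x : V × V, (if Meets e x.1 x.2 then 0 else
      f (Equiv.swap e.1 e.2 x.1, Equiv.swap e.1 e.2 x.2) ^ 2) =
      ∑ x : V × V, if Meets e x.1 x.2 then 0 else f x ^ 2 := by
    rw [← Equiv.sum_comp ((Equiv.swap e.1 e.2).prodCongr (Equiv.swap e.1 e.2))]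
    refine Finset.sum_congr rfl fun x _ => ?_
    simp [meets_swap]
  have : ∑ x : V × V, ((if Meets e x.1 x.2 then f x ^ 2 else
        (f x - f (Equiv.swap e.1 e.2 x.1, Equiv.swap e.1 e.2 x.2)) ^ 2 / 2) -
      (f x ^ 2 - if Meets e x.1 x.2 then 0
        else f x * f (Equiv.swap e.1 e.2 x.1, Equiv.swap e.1 e.2 x.2))) =
      ∑ x : V × V, ((if Meets e x.1 x.2 then 0 else
        f (Equiv.swap e.1 e.2 x.1, Equiv.swap e.1 e.2 x.2) ^ 2) / 2 -
      (if Meets e x.1 x.2 then 0 else f x ^ 2) / 2) := by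
    refine Finset.sum_congr rfl fun x _ => ?_
    split_ifs <;> ring
  rw [Finset.sum_sub_distrib, Finset.sum_sub_distrib (f := fun x : V × V => ite _ _ _ / 2),
    ← Finset.sum_div, ← Finset.sum_div, hs, sub_self] at this
  exact (sub_eq_zero.mp this).symm

/-- Freezing one token at `v` can only lower the Dirichlet form: what remains is the form of the
single walk, absorbed at `v`. -/
theorem sum_sq_sub_le_energy (hw : ∀ e, 0 ≤ w e) (h1 : ∑ e, w e = 1) {f : V × V → ℝ} {v : V}
    (hv : f (v, v) = 0) :
    ∑ e : V × V, w e * (f (e.1, v) - f (e.2, v)) ^ 2 ≤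
      ∑ x, f x * (f x - killedPair w f x) := by
  classical
  rw [sum_mul_sub_killedPair h1]
  refine Finset.sum_le_sum fun e _ => mul_le_mul_of_nonneg_left ?_ (hw e)
  obtain ⟨a, b⟩ := e
  have hnn : ∀ x ∈ (Finset.univ : Finset (V × V)), 0 ≤ if Meets (a, b) x.1 x.2 then f x ^ 2 else
      (f x - f (Equiv.swap a b x.1, Equiv.swap a b x.2)) ^ 2 / 2 := by
    intro x _; split_ifs <;> positivity
  by_cases hab : a = b
  · subst hab
    simpa using Finset.sum_nonneg hnn
  by_cases hav : a = v
  · subst hav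
    refine le_trans (le_of_eq ?_) (Finset.single_le_sum hnn (Finset.mem_univ (b, a)))
    simp [Meets, hv]
  by_cases hbv : b = v
  · subst hbv
    refine le_trans (le_of_eq ?_) (Finset.single_le_sum hnn (Finset.mem_univ (a, b)))
    simp [Meets, hv]
  · have hne : (a, v) ≠ (b, v) := by simp [hab]
    refine le_trans (le_of_eq ?_) (Finset.add_le_sum hnn (Finset.mem_univ (a, v))
      (Finset.mem_univ (b, v)) hne)
    have hm1 : ¬ Meets (a, b) a v := by simp [Meets, hbv, Ne.symm hab]
    have hm2 : ¬ Meets (a, b) b v := by simp [Meets, hab, hav]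
    have hsv : Equiv.swap a b v = v :=
      Equiv.swap_apply_of_ne_of_ne (Ne.symm hav) (Ne.symm hbv)
    simp only [hm1, hm2, if_false, hsv, Equiv.swap_apply_left, Equiv.swap_apply_right]
    ring

end

/-! ### Geodesics and effective resistance -/

/-- On a connected graph, the degrees along a geodesic add up to at most three times the number
of vertices, as a vertex is adjacent to at most three vertices of a geodesic. -/
theorem exists_geodesic {V : Type*} [Fintype V] {G : SimpleGraph V} [DecidableRel G.Adj]
    (hG : G.Connected) (u v : V) :
    ∃ p : ℕ → V, p 0 = u ∧ p (G.dist u v) = v ∧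
      (∀ i < G.dist u v, G.Adj (p i) (p (i + 1))) ∧
      (∀ i ≤ G.dist u v, G.dist u (p i) = i) ∧
      ∑ i ∈ Finset.range (G.dist u v), G.degree (p i) ≤ 3 * Fintype.card V := by
  obtain ⟨W, hW⟩ := hG.exists_walk_length_eq_dist u v
  have hdist : ∀ i ≤ G.dist u v, G.dist u (W.getVert i) = i := by
    intro i hi
    have h1 := SimpleGraph.dist_le (W.take i)
    have h2 := SimpleGraph.dist_le (W.drop i)
    have h3 := hG.dist_triangle (u := u) (v := W.getVert i) (w := v)
    rw [SimpleGraph.Walk.take_length] at h1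
    rw [SimpleGraph.Walk.drop_length] at h2
    omega
  refine ⟨W.getVert, W.getVert_zero, ?_, fun i hi => W.adj_getVert_succ (hW ▸ hi), hdist, ?_⟩
  · rw [← hW]; exact W.getVert_length
  · calc ∑ i ∈ Finset.range (G.dist u v), G.degree (W.getVert i)
        = ∑ i ∈ Finset.range (G.dist u v),
            (Finset.univ.bipartiteAbove (fun i z => G.Adj (W.getVert i) z) i).card := by
          refine Finset.sum_congr rfl fun i _ => ?_
          rw [← SimpleGraph.card_neighborFinset_eq_degree]
          congr 1
          ext z
          simp [Finset.bipartiteAbove]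
      _ = ∑ z : V, ((Finset.range (G.dist u v)).bipartiteBelow
            (fun i z => G.Adj (W.getVert i) z) z).card :=
          Finset.sum_card_bipartiteAbove_eq_sum_card_bipartiteBelow _
      _ ≤ ∑ _z : V, 3 := by
          refine Finset.sum_le_sum fun z _ => ?_
          refine (Finset.card_le_card (t := Finset.Icc (G.dist u z - 1) (G.dist u z + 1))
            fun i hi => ?_).trans (by rw [Nat.card_Icc]; omega)
          simp only [Finset.bipartiteBelow, Finset.mem_filter, Finset.mem_range] at hi
          have h1 := hdist i hi.1.le
          have h2 := hG.dist_triangle (u := u) (v := W.getVert i) (w := z)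
          have h3 := hG.dist_triangle (u := u) (v := z) (w := W.getVert i)
          have h4 := SimpleGraph.dist_eq_one_iff_adj.mpr hi.2
          have h5 := SimpleGraph.dist_eq_one_iff_adj.mpr hi.2.symm
          rw [Finset.mem_Icc]
          omega
      _ = 3 * Fintype.card V := by simp [mul_comm]

/-- The effective resistance between any two vertices is at most `3 N ^ 2`. -/
theorem sq_sub_le_energy {V : Type*} [Fintype V] {G : SimpleGraph V} [DecidableRel G.Adj]
    (hG : G.Connected) {w : V × V → ℝ} (hw : ∀ e, 0 ≤ w e)
    (hadj : ∀ a b, G.Adj a b → (Fintype.card V * G.degree a : ℝ)⁻¹ ≤ w (a, b))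
    (f : V → ℝ) (u v : V) :
    (f u - f v) ^ 2 ≤
      3 * (Fintype.card V : ℝ) ^ 2 * ∑ e : V × V, w e * (f e.1 - f e.2) ^ 2 := by
  classical
  obtain ⟨p, h0, hl, hp, hdist, hdeg⟩ := exists_geodesic hG u v
  set l := G.dist u v
  have hN : 0 < (Fintype.card V : ℝ) := by
    exact_mod_cast Fintype.card_pos_iff.mpr ⟨u⟩
  have hdpos : ∀ i ∈ Finset.range l, 0 < (G.degree (p i) : ℝ) := by
    intro i hi
    exact_mod_cast (G.degree_pos_iff_exists_adj _).mpr ⟨_, hp i (Finset.mem_range.mp hi)⟩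
  have htel : f u - f v = ∑ i ∈ Finset.range l, (f (p i) - f (p (i + 1))) := by
    rw [Finset.sum_range_sub' (fun i => f (p i)), h0, hl]
  have hinj : Set.InjOn (fun i => (p i, p (i + 1))) (Finset.range l : Set ℕ) := by
    intro i hi j hj hij
    rw [Finset.coe_range, Set.mem_Iio] at hi hj
    rw [← hdist i hi.le, ← hdist j hj.le, (Prod.mk.inj hij).1]
  rw [htel]
  calc (∑ i ∈ Finset.range l, (f (p i) - f (p (i + 1)))) ^ 2
      ≤ (∑ i ∈ Finset.range l, (G.degree (p i) : ℝ)) *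
          ∑ i ∈ Finset.range l, (f (p i) - f (p (i + 1))) ^ 2 / G.degree (p i) := by
        refine Finset.sum_sq_le_sum_mul_sum_of_sq_le_mul _ (fun i hi => (hdpos i hi).le)
          (fun i hi => div_nonneg (sq_nonneg _) (hdpos i hi).le) fun i hi => ?_
        rw [mul_div_cancel₀ _ (hdpos i hi).ne']
    _ ≤ (3 * Fintype.card V) *
          ∑ i ∈ Finset.range l, Fintype.card V *
            (w (p i, p (i + 1)) * (f (p i) - f (p (i + 1))) ^ 2) := by
        gcongr with i hi
        · exact_mod_cast hdeg
        · have h := hadj _ _ (hp i (Finset.mem_range.mp hi))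
          rw [mul_inv, inv_mul_le_iff₀ hN] at h
          rw [div_eq_inv_mul, ← mul_assoc]
          exact mul_le_mul_of_nonneg_right h (sq_nonneg _)
    _ = 3 * (Fintype.card V : ℝ) ^ 2 * ∑ e ∈ (Finset.range l).image fun i => (p i, p (i + 1)),
          w e * (f e.1 - f e.2) ^ 2 := by
        rw [Finset.sum_image hinj, ← Finset.mul_sum]
        ring
    _ ≤ _ := by
        gcongr
        · exact fun e _ _ => mul_nonneg (hw e) (sq_nonneg _)
        · exact Finset.subset_univ _

/-! ### The encounter time of two tokens -/

/-- The truncated expected encounter time `∑ k < n, avoid w k` is at most `3 N ^ 4`: its Dirichlet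
form is at most its sum over the `N ^ 2` pairs, hence at most `N ^ 2` times its maximum, while the
square of the maximum is at most `3 N ^ 2` times the Dirichlet form. -/
theorem sum_avoid_le {V : Type*} [Fintype V] [DecidableEq V] {G : SimpleGraph V}
    [DecidableRel G.Adj] (hG : G.Connected) {w : V × V → ℝ} (hw : ∀ e, 0 ≤ w e) (h1 : ∑ e, w e = 1)
    (hadj : ∀ a b, G.Adj a b → (Fintype.card V * G.degree a : ℝ)⁻¹ ≤ w (a, b))
    (n : ℕ) (x : V × V) :
    ∑ k ∈ Finset.range n, avoid w k x ≤ 3 * (Fintype.card V : ℝ) ^ 4 := by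
  set H : V × V → ℝ := fun x => ∑ k ∈ Finset.range n, avoid w k x with hH
  have : Nonempty (V × V) := ⟨x⟩
  obtain ⟨⟨u, v⟩, hmax⟩ := Finite.exists_max H
  have hH0 : ∀ x, 0 ≤ H x := fun x => Finset.sum_nonneg fun k _ => avoid_nonneg hw k x
  have hdiag : ∀ v, H (v, v) = 0 := fun v => Finset.sum_eq_zero fun k _ => avoid_diag k v
  have hgen : ∀ x, H x - killedPair w H x ≤ 1 := by
    intro x
    have : H x - killedPair w H x = avoid w 0 x - avoid w n x := by
      rw [hH, killedPair_sum, ← Finset.sum_sub_distrib]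
      exact Finset.sum_range_sub' (fun k => avoid w k x) n
    have h0 : avoid w 0 x ≤ 1 := by simp only [avoid]; split_ifs <;> norm_num
    linarith [avoid_nonneg hw n x]
  have hE : ∑ x, H x * (H x - killedPair w H x) ≤ (Fintype.card V : ℝ) ^ 2 * H (u, v) := by
    calc ∑ x, H x * (H x - killedPair w H x) ≤ ∑ _x : V × V, H (u, v) := by
          refine Finset.sum_le_sum fun x _ => ?_
          nlinarith [hgen x, hmax x, hH0 x]
      _ = (Fintype.card V : ℝ) ^ 2 * H (u, v) := by simp [sq]
  have hR := sq_sub_le_energy hG hw hadj (fun a => H (a, v)) u v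
  have hF := sum_sq_sub_le_energy hw h1 (hdiag v)
  simp only [hdiag, sub_zero] at hR
  have hM : H (u, v) ^ 2 ≤ 3 * (Fintype.card V : ℝ) ^ 4 * H (u, v) :=
    calc H (u, v) ^ 2 ≤ 3 * (Fintype.card V : ℝ) ^ 2 * ((Fintype.card V : ℝ) ^ 2 * H (u, v)) :=
          hR.trans (mul_le_mul_of_nonneg_left (hF.trans hE) (by positivity))
      _ = _ := by ring
  refine (hmax x).trans ?_
  by_contra! hlt
  have hpos : 0 < H (u, v) := lt_of_le_of_lt (by positivity) hlt
  nlinarith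

/-- Markov's inequality for the encounter time, whose expectation is at most `3 N ^ 4`. -/
theorem avoid_le_half {V : Type*} [Fintype V] [DecidableEq V] {G : SimpleGraph V}
    [DecidableRel G.Adj] (hG : G.Connected) {w : V × V → ℝ} (hw : ∀ e, 0 ≤ w e) (h1 : ∑ e, w e = 1)
    (hadj : ∀ a b, G.Adj a b → (Fintype.card V * G.degree a : ℝ)⁻¹ ≤ w (a, b)) (x : V × V) :
    avoid w (6 * Fintype.card V ^ 4) x ≤ 1 / 2 := by
  set n := 6 * Fintype.card V ^ 4 with hn
  have h : (n : ℝ) * avoid w n x ≤ 3 * (Fintype.card V : ℝ) ^ 4 := by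
    refine le_trans ?_ (sum_avoid_le hG hw h1 hadj n x)
    rw [← nsmul_eq_mul]
    simpa using Finset.card_nsmul_le_sum (Finset.range n) (fun k => avoid w k x) (avoid w n x)
      fun k hk => avoid_antitone hw h1 x (Finset.mem_range.mp hk).le
  have hN : 0 < (Fintype.card V : ℝ) ^ 4 := by
    have : 0 < Fintype.card V := Fintype.card_pos_iff.mpr ⟨x.1⟩
    positivity
  rw [hn] at h
  push_cast at h
  rw [← hn] at h
  nlinarith

/-! ### The activation law -/

theorem sum_activation_toReal {N : ℕ} [NeZero N] (G : SimpleGraph (Fin N)) :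
    ∑ e, (activation G e).toReal = 1 := by
  rw [← ENNReal.toReal_sum fun e _ => PMF.apply_ne_top _ _,
    ← tsum_fintype (L := .unconditional _), PMF.tsum_coe, ENNReal.toReal_one]

theorem inv_le_activation_toReal {N : ℕ} [NeZero N] (G : SimpleGraph (Fin N))
    [DecidableRel G.Adj] (a b : Fin N) (h : G.Adj a b) :
    (Fintype.card (Fin N) * G.degree a : ℝ)⁻¹ ≤ (activation G (a, b)).toReal := by
  have hle : (N : ℝ≥0∞)⁻¹ * (G.degree a : ℝ≥0∞)⁻¹ ≤ activation G (a, b) := by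
    classical
    rw [activation, PMF.bind_apply]
    refine le_trans ?_ (ENNReal.le_tsum a)
    have hn : (G.neighborFinset a).Nonempty := ⟨b, by simpa using h⟩
    rw [PMF.uniformOfFintype_apply, Fintype.card_fin]
    gcongr
    rw [dif_pos (by convert hn), PMF.map_apply]
    refine le_trans ?_ (ENNReal.le_tsum b)
    rw [if_pos rfl, PMF.uniformOfFinset_apply_of_mem _ (by simpa using h),
      SimpleGraph.card_neighborFinset_eq_degree]
    simp [SimpleGraph.degree, SimpleGraph.neighborFinset]
  rw [Fintype.card_fin]
  have := ENNReal.toReal_mono (PMF.apply_ne_top _ _) hle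
  rwa [ENNReal.toReal_mul, ENNReal.toReal_inv, ENNReal.toReal_inv, ENNReal.toReal_natCast,
    ENNReal.toReal_natCast, ← mul_inv] at this

/-! ### Events of an independent sequence -/

/-- A property of sequences that depends on the coordinates in `S` only is a property of the
restriction to `S`. -/
theorem exists_preimage_restrict {Ω β : Type*} [Nonempty β] {p : (ℕ → β) → Prop} {S : Finset ℕ}
    (hp : ∀ a b : ℕ → β, (∀ i ∈ S, a i = b i) → (p a ↔ p b)) (A : ℕ → Ω → β) :
    ∃ s : Set (S → β), {ω | p fun t => A t ω} = (fun ω (i : S) => A i ω) ⁻¹' s := by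
  classical
  obtain ⟨b⟩ := ‹Nonempty β›
  refine ⟨{c | p fun t => if h : t ∈ S then c ⟨t, h⟩ else b}, ?_⟩
  ext ω
  exact hp _ _ fun i hi => by simp [hi]

section
variable {Ω : Type*} [MeasurableSpace Ω] {P : Measure Ω} {β : Type*} [MeasurableSpace β]
  [Finite β] [MeasurableSingletonClass β] {A : ℕ → Ω → β}

theorem nullMeasurableSet_of_finite_coordinates [Nonempty β] (hA : ∀ t, AEMeasurable (A t) P)
    {p : (ℕ → β) → Prop} {S : Finset ℕ}
    (hp : ∀ a b : ℕ → β, (∀ i ∈ S, a i = b i) → (p a ↔ p b)) :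
    NullMeasurableSet {ω | p fun t => A t ω} P := by
  obtain ⟨s, hs⟩ := exists_preimage_restrict hp A
  rw [hs]
  exact (aemeasurable_pi_lambda _ fun i : S => hA i).nullMeasurableSet_preimage
    (Set.toFinite s).measurableSet

theorem measure_and_of_disjoint_coordinates [Nonempty β] (hA : ∀ t, AEMeasurable (A t) P)
    (hi : iIndepFun A P) {p q : (ℕ → β) → Prop} {S T : Finset ℕ} (hST : Disjoint S T)
    (hp : ∀ a b : ℕ → β, (∀ i ∈ S, a i = b i) → (p a ↔ p b))
    (hq : ∀ a b : ℕ → β, (∀ i ∈ T, a i = b i) → (q a ↔ q b)) :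
    P {ω | p (fun t => A t ω) ∧ q fun t => A t ω} =
      P {ω | p fun t => A t ω} * P {ω | q fun t => A t ω} := by
  obtain ⟨s, hs⟩ := exists_preimage_restrict hp A
  obtain ⟨t, ht⟩ := exists_preimage_restrict hq A
  rw [Set.ofPred_and, hs, ht]
  exact (hi.indepFun_finset₀ S T hST hA).measure_inter_preimage_eq_mul s t
    (Set.toFinite s).measurableSet (Set.toFinite t).measurableSet

end

/-! ### Windows and blocks of ticks -/

/-- First-step analysis: the activated pair of the first tick is independent of the later ones, and
the recursion for `avoid` sums over its values. -/
theorem measure_unmet_le {N : ℕ} [NeZero N] {G : SimpleGraph (Fin N)} {Ω : Type*}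
    [MeasurableSpace Ω] {P : Measure Ω} [IsProbabilityMeasure P] {A : ℕ → Ω → Fin N × Fin N}
    (hA : ∀ t, HasLaw (A t) (activation G).toMeasure P) (hi : iIndepFun A P) (n s : ℕ)
    {u v : Fin N} (huv : u ≠ v) :
    P {ω | Unmet (fun t => A (s + t) ω) n u v} ≤
      ENNReal.ofReal (avoid (fun e => (activation G e).toReal) n (u, v)) := by
  classical
  induction n generalizing s u v with
  | zero => simpa [avoid, huv] using prob_le_one
  | succ n ih =>
    have hsub : {ω | Unmet (fun t => A (s + t) ω) (n + 1) u v} ⊆ ⋃ e : Fin N × Fin N,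
        {ω | ¬ Meets e u v ∧ A s ω = e ∧ Unmet (fun t => A (s + 1 + t) ω) n
          (Equiv.swap e.1 e.2 u) (Equiv.swap e.1 e.2 v)} := by
      intro ω hω
      obtain ⟨h1, h2⟩ := (unmet_succ _ _ _ _).mp hω
      refine Set.mem_iUnion.mpr ⟨A s ω, h1, rfl, ?_⟩
      simp only [add_assoc, add_comm 1]
      exact h2
    refine (measure_mono hsub).trans ((measure_iUnion_fintype_le _ _).trans ?_)
    rw [avoid, killedPair, ENNReal.ofReal_sum_of_nonneg]
    · refine Finset.sum_le_sum fun e _ => ?_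
      by_cases he : Meets e u v
      · simp [he]
      · simp only [he, not_false_eq_true, true_and, if_false]
        rw [measure_and_of_disjoint_coordinates (fun t => (hA t).aemeasurable) hi
          (p := fun a => a s = e) (S := {s})
          (T := Finset.Ico (s + 1) (s + 1 + n))
          (q := fun a => Unmet (fun t => a (s + 1 + t)) n
            (Equiv.swap e.1 e.2 u) (Equiv.swap e.1 e.2 v)),
          ENNReal.ofReal_mul ENNReal.toReal_nonneg,
          ENNReal.ofReal_toReal (PMF.apply_ne_top _ _)]
        · refine mul_le_mul' (le_of_eq ?_) (ih _ ?_)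
          · rw [← PMF.toMeasure_apply_singleton _ _ (measurableSet_singleton e),
              ← (hA s).map_eq, Measure.map_apply_of_aemeasurable (hA s).aemeasurable
              (measurableSet_singleton e)]
            rfl
          · simpa using huv
        · rw [Finset.disjoint_singleton_left, Finset.mem_Ico]
          omega
        · intro a b h
          rw [h s (Finset.mem_singleton_self s)]
        · intro a b h
          exact unmet_congr (fun k hk => h _ (Finset.mem_Ico.mpr ⟨by omega, by omega⟩)) _ _
    · intro e _
      split_ifs
      · exact le_rfl
      · exact mul_nonneg ENNReal.toReal_nonneg (avoid_nonneg (fun _ => ENNReal.toReal_nonneg) _ _)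

/-- The number of ticks in a window. In `6 N ^ 4` ticks a given pair of tokens fails to interact
with probability at most `1 / 2`; repeating this `2 * clog 2 N + 2` times brings the probability
down to at most `1 / (4 N ^ 2)`. -/
def windowLength (N : ℕ) : ℕ := (2 * Nat.clog 2 N + 2) * (6 * N ^ 4)

theorem measure_badWindow_le {N : ℕ} [NeZero N] {G : SimpleGraph (Fin N)} (hG : G.Connected)
    {Ω : Type*} [MeasurableSpace Ω] {P : Measure Ω} [IsProbabilityMeasure P]
    {A : ℕ → Ω → Fin N × Fin N}
    (hA : ∀ t, HasLaw (A t) (activation G).toMeasure P) (hi : iIndepFun A P) (s : ℕ) :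
    P {ω | BadWindow (fun t => A (s + t) ω) (windowLength N)} ≤ 4⁻¹ := by
  classical
  have hpair : ∀ x : Fin N × Fin N,
      P {ω | x.1 ≠ x.2 ∧ Unmet (fun t => A (s + t) ω) (windowLength N) x.1 x.2} ≤
        ENNReal.ofReal ((1 / 2) ^ (2 * Nat.clog 2 N + 2)) := by
    rintro ⟨u, v⟩
    by_cases huv : u = v
    · simp [huv]
    · simp only [ne_eq, huv, not_false_eq_true, true_and]
      refine (measure_unmet_le hA hi _ s huv).trans (ENNReal.ofReal_le_ofReal ?_)
      refine avoid_mul_le_pow (fun _ => ENNReal.toReal_nonneg) (by norm_num) (fun x => ?_) _ _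
      simpa using avoid_le_half hG (fun _ => ENNReal.toReal_nonneg) (sum_activation_toReal G)
        (inv_le_activation_toReal G) x
  have hsub : {ω | BadWindow (fun t => A (s + t) ω) (windowLength N)} ⊆
      ⋃ x : Fin N × Fin N,
        {ω | x.1 ≠ x.2 ∧ Unmet (fun t => A (s + t) ω) (windowLength N) x.1 x.2} := by
    rintro ω ⟨u, v, h⟩
    exact Set.mem_iUnion.mpr ⟨(u, v), h⟩
  refine (measure_mono hsub).trans ((measure_iUnion_fintype_le _ _).trans
    ((Finset.sum_le_sum fun x _ => hpair x).trans ?_))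
  rw [← ENNReal.ofReal_sum_of_nonneg fun _ _ => by positivity,
    show (4⁻¹ : ℝ≥0∞) = ENNReal.ofReal 4⁻¹ by
      rw [ENNReal.ofReal_inv_of_pos (by norm_num)]; norm_num]
  refine ENNReal.ofReal_le_ofReal ?_
  have hclog : (N : ℝ) ≤ 2 ^ Nat.clog 2 N := by exact_mod_cast Nat.le_pow_clog one_lt_two N
  have hN : (0 : ℝ) ≤ N := Nat.cast_nonneg N
  simp only [Finset.sum_const, Finset.card_univ, Fintype.card_prod, Fintype.card_fin,
    nsmul_eq_mul, Nat.cast_mul]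
  rw [pow_add, mul_comm 2, pow_mul, div_pow, one_pow, div_pow, one_pow, ← mul_assoc]
  have h2 : (N : ℝ) * N ≤ (2 ^ Nat.clog 2 N) ^ 2 := by nlinarith
  have h3 : (N : ℝ) * N * (1 / (2 ^ Nat.clog 2 N) ^ 2) ≤ 1 := by
    rw [mul_one_div]
    exact div_le_one_of_le₀ h2 (by positivity)
  linarith

/-- The `k`-th block consists of two consecutive windows of length `n`; it is bad if one of them
is. -/
def BadBlock {V : Type*} [DecidableEq V] (a : ℕ → V × V) (n k : ℕ) : Prop :=
  BadWindow (fun t => a (k * (n + n) + t)) n ∨ BadWindow (fun t => a (k * (n + n) + n + t)) n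

theorem badBlock_congr {V : Type*} [DecidableEq V] {a b : ℕ → V × V} {n k : ℕ}
    (h : ∀ t ∈ Finset.Ico (k * (n + n)) ((k + 1) * (n + n)), a t = b t) :
    BadBlock a n k ↔ BadBlock b n k := by
  have hk : (k + 1) * (n + n) = k * (n + n) + n + n := by ring
  refine or_congr ?_ ?_ <;>
  · refine exists₂_congr fun u v => and_congr_right fun _ => unmet_congr (fun j hj => ?_) u v
    exact h _ (Finset.mem_Ico.mpr ⟨by omega, by omega⟩)

theorem allBad_congr {V : Type*} [DecidableEq V] {a b : ℕ → V × V} {n k : ℕ}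
    (h : ∀ t ∈ Finset.range (k * (n + n)), a t = b t) :
    (∀ i < k, BadBlock a n i) ↔ ∀ i < k, BadBlock b n i := by
  refine forall₂_congr fun i hi => badBlock_congr fun t ht => h t ?_
  exact Finset.mem_range.mpr
    ((Finset.mem_Ico.mp ht).2.trans_le (Nat.mul_le_mul_right _ hi))

/-- Disjoint blocks are independent, and each of them is bad with probability at most
`1 / 4 + 1 / 4`. -/
theorem measure_allBad_le {N : ℕ} [NeZero N] {G : SimpleGraph (Fin N)} (hG : G.Connected)
    {Ω : Type*} [MeasurableSpace Ω] {P : Measure Ω} [IsProbabilityMeasure P]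
    {A : ℕ → Ω → Fin N × Fin N}
    (hA : ∀ t, HasLaw (A t) (activation G).toMeasure P) (hi : iIndepFun A P) (k : ℕ) :
    P {ω | ∀ i < k, BadBlock (fun t => A t ω) (windowLength N) i} ≤ 2⁻¹ ^ k := by
  induction k with
  | zero => simp
  | succ k ih =>
    simp only [Nat.forall_lt_succ_right]
    rw [measure_and_of_disjoint_coordinates (fun t => (hA t).aemeasurable) hi
      (p := fun a => ∀ i < k, BadBlock a (windowLength N) i)
      (q := fun a => BadBlock a (windowLength N) k) (S := Finset.range _) (T := Finset.Ico _ _)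
      ?_ (fun a b h => allBad_congr h) (fun a b h => badBlock_congr h), pow_succ]
    · refine mul_le_mul' ih ?_
      calc P {ω | BadBlock (fun t => A t ω) (windowLength N) k} ≤ 4⁻¹ + 4⁻¹ :=
            (measure_union_le _ _).trans
              (add_le_add (measure_badWindow_le hG hA hi _) (measure_badWindow_le hG hA hi _))
        _ = 2⁻¹ := by
            rw [← two_mul, show (4 : ℝ≥0∞) = 2 * 2 by norm_num,
              ENNReal.mul_inv (by simp) (by simp), ← mul_assoc,
              ENNReal.mul_inv_cancel (by simp) (by simp), one_mul]
    · rw [Finset.disjoint_left]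
      intro t h1 h2
      exact absurd (Finset.mem_range.mp h1) (Finset.mem_Ico.mp h2).1.not_gt

/-! ### The expected convergence time -/

/-- Consensus is reached by the end of the first good block. -/
theorem convergenceTime_le_tsum {N : ℕ} {x : Config N} (hx : imbalance x ≠ 0)
    (a : ℕ → Fin N × Fin N) {n : ℕ} (hn : 0 < n) :
    convergenceTime x a ≤
      ∑' k, {k : ℕ | ∀ i < k, BadBlock a n i}.indicator (fun _ => ((n + n : ℕ) : ℝ≥0∞)) k := by
  classical
  by_cases hall : ∀ i, BadBlock a n i
  · have : {k : ℕ | ∀ i < k, BadBlock a n i} = Set.univ :=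
      Set.eq_univ_of_forall fun k i _ => hall i
    rw [this, Set.indicator_univ, ENNReal.tsum_const_eq_top_of_ne_zero]
    · exact le_top
    · exact_mod_cast (by omega : n + n ≠ 0)
  · push Not at hall
    have hfirst : ∀ k ≤ Nat.find hall, ∀ i < k, BadBlock a n i := fun k hk i hi =>
      not_not.mp (Nat.find_min hall (hi.trans_le hk))
    have hgood := Nat.find_spec hall
    generalize Nat.find hall = m at hfirst hgood
    have hconv : Converged (trajectory x a (m * (n + n) + (n + n))) := by
      rw [trajectory_add]
      rw [BadBlock, not_or] at hgood
      refine converged_of_windows (by rwa [imbalance_trajectory]) _ n hgood.1 ?_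
      simpa only [add_assoc] using hgood.2
    calc convergenceTime x a ≤ ((m * (n + n) + (n + n) : ℕ) : ℝ≥0∞) :=
          iInf₂_le (m * (n + n) + (n + n)) hconv
      _ = ∑ k ∈ Finset.range (m + 1),
            {k : ℕ | ∀ i < k, BadBlock a n i}.indicator (fun _ => ((n + n : ℕ) : ℝ≥0∞)) k := by
          rw [Finset.sum_congr rfl fun k hk => Set.indicator_of_mem (s := {k : ℕ | ∀ i < k,
            BadBlock a n i}) (hfirst k (Nat.lt_succ_iff.mp (Finset.mem_range.mp hk))) _]
          rw [Finset.sum_const, Finset.card_range, nsmul_eq_mul, ← Nat.cast_mul]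
          rw [Nat.succ_mul]
      _ ≤ _ := ENNReal.sum_le_tsum _

theorem lintegral_convergenceTime_le {N : ℕ} [NeZero N] {G : SimpleGraph (Fin N)}
    (hG : G.Connected) {x : Config N} (hx : imbalance x ≠ 0)
    {Ω : Type*} [MeasurableSpace Ω] {P : Measure Ω} [IsProbabilityMeasure P]
    {A : ℕ → Ω → Fin N × Fin N}
    (hA : ∀ t, HasLaw (A t) (activation G).toMeasure P) (hi : iIndepFun A P) :
    ∫⁻ ω, convergenceTime x (fun t => A t ω) ∂P ≤ ((4 * windowLength N : ℕ) : ℝ≥0∞) := by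
  set n := windowLength N with hn
  have hn0 : 0 < n := by
    have : 0 < N := Nat.pos_of_ne_zero (NeZero.ne N)
    rw [hn, windowLength]
    positivity
  have hmeas : ∀ k, NullMeasurableSet {ω | ∀ i < k, BadBlock (fun t => A t ω) n i} P := fun k =>
    nullMeasurableSet_of_finite_coordinates (fun t => (hA t).aemeasurable)
      (p := fun a => ∀ i < k, BadBlock a n i) (S := Finset.range _) fun a b h => allBad_congr h
  calc ∫⁻ ω, convergenceTime x (fun t => A t ω) ∂P
      ≤ ∫⁻ ω, ∑' k, {ω | ∀ i < k, BadBlock (fun t => A t ω) n i}.indicator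
          (fun _ => ((n + n : ℕ) : ℝ≥0∞)) ω ∂P :=
        lintegral_mono fun ω => convergenceTime_le_tsum hx _ hn0
    _ = ∑' k, ((n + n : ℕ) : ℝ≥0∞) * P {ω | ∀ i < k, BadBlock (fun t => A t ω) n i} := by
        rw [lintegral_tsum fun k => aemeasurable_const.indicator₀ (hmeas k)]
        exact tsum_congr fun k => lintegral_indicator_const₀ (hmeas k) _
    _ ≤ ∑' k, ((n + n : ℕ) : ℝ≥0∞) * 2⁻¹ ^ k :=
        ENNReal.tsum_le_tsum fun k => mul_le_mul_right (measure_allBad_le hG hA hi k) _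
    _ = ((4 * n : ℕ) : ℝ≥0∞) := by
        rw [ENNReal.tsum_mul_left, ENNReal.tsum_geometric, ENNReal.one_sub_inv_two, inv_inv]
        push_cast
        ring

theorem windowLength_le {N : ℕ} (hN : 2 ≤ N) :
    (4 * windowLength N : ℝ) ≤ 288 * ((N : ℝ) ^ 4 * Real.log N) := by
  have hpow : (2 : ℝ) ^ (Nat.clog 2 N - 1) ≤ N := by
    exact_mod_cast (Nat.pow_pred_clog_lt_self one_lt_two (by omega)).le
  have hlog : ((Nat.clog 2 N - 1 : ℕ) : ℝ) * Real.log 2 ≤ Real.log N := by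
    rw [← Real.log_pow]
    exact Real.log_le_log (by positivity) hpow
  have h2 : Real.log 2 ≤ Real.log N := Real.log_le_log two_pos (by exact_mod_cast hN)
  have hhalf : (1 / 2 : ℝ) ≤ Real.log 2 := by linarith [Real.log_two_gt_d9]
  have hclog : 1 ≤ Nat.clog 2 N := Nat.clog_pos one_lt_two hN
  rw [Nat.cast_sub hclog, Nat.cast_one] at hlog
  have hc : (1 : ℝ) ≤ Nat.clog 2 N := by exact_mod_cast hclog
  -- `clog 2 N + 1 ≤ log N / log 2 + 2 ≤ 3 * log N / log 2`, and `log 2 ≥ 1 / 2`.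
  have hkey : (Nat.clog 2 N + 1 : ℝ) ≤ 6 * Real.log N := by nlinarith
  have := mul_le_mul_of_nonneg_left hkey (by positivity : (0 : ℝ) ≤ 48 * (N : ℝ) ^ 4)
  rw [windowLength]
  push_cast
  linarith

/-- For `N = 1` the bound `N ^ 4 * log N` vanishes, but the single vote is already a consensus. -/
theorem convergenceTime_eq_zero_of_card_one (x : Config 1) (a : ℕ → Fin 1 × Fin 1) :
    convergenceTime x a = 0 := by
  have h : Converged (trajectory x a 0) := by
    simp only [trajectory, Converged, Fin.forall_fin_one]
    cases x 0 <;> simp [Opinion.val]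
  exact nonpos_iff_eq_zero.mp ((iInf₂_le 0 h).trans (by simp))

end BinaryVoting

theorem mainTheorem1 :
    ∃ C : ℝ, 0 < C ∧
      ∀ (N : ℕ) [NeZero N] (G : SimpleGraph (Fin N)), G.Connected →
      ∀ vote : Fin N → Bool,
        (Finset.univ.filter fun i => BinaryVoting.initial vote i = .strongPos).card ≠
          (Finset.univ.filter fun i => BinaryVoting.initial vote i = .strongNeg).card →
      ∀ {Ω : Type*} [MeasurableSpace Ω] (P : Measure Ω) [IsProbabilityMeasure P]
        (A : ℕ → Ω → Fin N × Fin N),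
        (∀ t, HasLaw (A t) (BinaryVoting.activation G).toMeasure P) → iIndepFun A P →
        ∫⁻ ω, BinaryVoting.convergenceTime (BinaryVoting.initial vote) (fun t => A t ω) ∂P ≤
          ENNReal.ofReal (C * ((N : ℝ) ^ 4 * Real.log N)) := by
  refine ⟨288, by norm_num, ?_⟩
  intro N _ G hG vote hvote Ω _ P _ A hA hi
  rcases (Nat.one_le_iff_ne_zero.mpr (NeZero.ne N)).eq_or_lt with rfl | hN
  · simp [BinaryVoting.convergenceTime_eq_zero_of_card_one]
  · refine (BinaryVoting.lintegral_convergenceTime_le hG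
      (BinaryVoting.imbalance_initial_ne_zero vote hvote) hA hi).trans ?_
    rw [← ENNReal.ofReal_natCast]
    refine ENNReal.ofReal_le_ofReal ?_
    push_cast
    exact BinaryVoting.windowLength_le hN
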